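/- Let $F$ be a field of characteristic $p$ (zero or prime), and let $f=g/h\in F(X)$ with $g,h\in F[X]$ coprime, $h\neq 0$. Put $\deg f=\max\{\deg g,\deg h\}$, $d=\deg f$, and define the iterates of $f$ by $f^{(0)}=X$ and $f^{(k)}=f\circ f^{(k-1)}$ for $k\ge 1$. Suppose that $d\ge 2$, and that - $f$ is not a monomial $aX^m$ with $a\in F$ and $m\in\mathbb{Z}$ (negative exponents included); - $f$ is not a binomial of the form $aX^{p^\ell}+b$ with $a,b\in F$ and $\ell\ge 0$; - $f$ is not linearly conjugate to $1/X^d$ over $F$, i.e. there is no $\psi\in F(X)$ of degree $1$ with $1/X^d=\psi^{-1}\circ f\circ\psi$. Suppose moreover that at least one of the following holds: - $\deg g\ge 1$ and $\deg g\neq\deg h$; - $f$ is separable (that is, $F(X)$ is a separable extension of $F(f)$); - $f$ is not of the form $L(X^{p^\ell})$ with $L\in F(X)$ of degree $1$ and $\ell\ge 0$. Then for every $n\ge 1$ the iterates $f^{(1)},\dots,f^{(n)}$ are multiplicatively independent: for integers $k_1,\dots,k_n$ one has $(f^{(1)})^{k_1}\cdots(f^{(n)})^{k_n}=1$ in $F(X)$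 if and only if $k_1=\dots=k_n=0$. -/

import Mathlib

open Polynomial

namespace RatIter

noncomputable section

/-- The degree of a rational function: the maximum of the degrees of numerator and denominator
in lowest terms. -/
def degree {F : Type*} [Field F] (f : RatFunc F) : ℕ :=
  max f.num.natDegree f.denom.natDegree

/-- The composition `u ∘ v`, i.e. `u(v(X))`. The denominator of `u` evaluated at a nonconstant `v`
is nonzero, so this is the usual composition whenever `v` is nonconstant. -/
def comp {F : Type*} [Field F] (u v : RatFunc F) : RatFunc F :=
  RatFunc.eval (RatFunc.C : F →+* RatFunc F) v u

/-- The iterates `f^(0) = X` and `f^(k+1) = f ∘ f^(k)`. -/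
def iter {F : Type*} [Field F] (f : RatFunc F) : ℕ → RatFunc F
  | 0 => RatFunc.X
  | k + 1 => comp f (iter f k)

/-- `φ` and `φ'` are linearly conjugate (over `F`): `φ' = ψ⁻¹ ∘ φ ∘ ψ` for some `ψ ∈ F(X)` of
degree one, where `ψ⁻¹ = ψ'` is the inverse of `ψ` for composition. -/
def LinearlyConjugate {F : Type*} [Field F] (φ φ' : RatFunc F) : Prop :=
  ∃ ψ ψ' : RatFunc F, degree ψ = 1 ∧ comp ψ ψ' = RatFunc.X ∧ comp ψ' ψ = RatFunc.X ∧
    φ' = comp ψ' (comp φ ψ)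

/-- A rational function `f` is separable if `F(X)` is a separable extension of `F(f)`. -/
def Separable {F : Type*} [Field F] (f : RatFunc F) : Prop :=
  Algebra.IsSeparable (IntermediateField.adjoin F {f}) (RatFunc F)

/-- Elements `u_1, …, u_n` of a field are multiplicatively independent if a product of integer
powers of them equals one only when all exponents vanish. -/
def MultiplicativelyIndependent {K : Type*} [Field K] {n : ℕ} (u : Fin n → K) : Prop :=
  ∀ k : Fin n → ℤ, ∏ i, u i ^ k i = 1 ↔ ∀ i, k i = 0

end

end RatIter

/-!
Let `K` be an algebraic closure of `F` and let `φ` be the self-map of `ℙ¹(K)` induced by `f`.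

Consider a multiplicative relation between the iterates, and let `f^(m)` be the last one occurring
in it. Every zero or pole of `f^(m)` must cancel against a zero or pole of an earlier iterate, so
`φ^{-m}({0, ∞})` is covered by `φ^{-j}({0, ∞})` for `1 ≤ j < m`
(`exists_iterate_mem_of_prod_eq_one`). The union `T` of these finitely many finite sets then
satisfies `φ⁻¹(T) ⊆ T`; as `φ` is surjective, counting shows that `φ` permutes `T`, that every
point of `T` has a single preimage, and that `T` contains `{0, ∞}`
(`exists_finite_totally_invariant`).

A point with a single preimage is totally ramified, so for `t ∈ T` the polynomial `g - t h` (or `h`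
for `t = ∞`) is a constant times the `d`-th power of a linear form (`form_eq_of_fiber_subsingleton`).
If `T = {0, ∞}`, then `g` and `h` are monomials and so is `f`. If `T` has a third point, three
`d`-th powers of pairwise independent linear forms are linearly dependent. Eliminating between this
relation and its derivative shows that `d` is a power `q` of the characteristic
(`exists_eq_pow_of_pow_relation`), so that `f = L(X^q)` with `L` of degree one, first over `K` and
then over `F` by looking at coefficients. Such an `f` is inseparable; and if moreover `deg g ≥ 1` and
`deg g ≠ deg h`, then `h` is constant and `f` is a binomial. Thus each alternative of the
hypothesis excludes this case.

Points of `ℙ¹(K)` are encoded as `OnePoint K`. The value of a rational function at a point is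
its residue for a valuation of `K(X)` trivial on `K` (`SpecializesTo`); this handles `∞` on the same
footing as the finite points, and makes the value of an iterate the iterate of the values
(`specializesTo_iter`).
-/

namespace IterateIndependence

open scoped OnePoint

/-! ### Points of the projective line -/

section ProjectiveLine

variable {K : Type*} [Field K]

/-- The linear form vanishing at the point `t` of `ℙ¹(K) = OnePoint K`, evaluated at homogeneous
coordinates `(a : b)` in a `K`-algebra: it is `b` for `t = ∞` and `a - t b` otherwise. -/
noncomputable def form {R : Type*} [CommRing R] [Algebra K R] (t : OnePoint K) (a b : R) : R :=
  t.elim b fun c => a - algebraMap K R c * b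

/-- The point of `ℙ¹(K) = OnePoint K` with homogeneous coordinates `(a : b)`. -/
noncomputable def ratio (a b : K) : OnePoint K :=
  open scoped Classical in if b = 0 then ∞ else ((a / b : K) : OnePoint K)

/-- The self-map of `ℙ¹(K) = OnePoint K` induced by the fraction `g / h`. Its value at `∞` is read
off the coefficients in degree `max (deg g) (deg h)`. -/
noncomputable def projMap (g h : K[X]) (s : OnePoint K) : OnePoint K :=
  s.elim (ratio (g.coeff (max g.natDegree h.natDegree)) (h.coeff (max g.natDegree h.natDegree)))
    fun x => ratio (g.eval x) (h.eval x)

section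
variable {R : Type*} [CommRing R] [Algebra K R]

@[simp] lemma form_infty (a b : R) : form (∞ : OnePoint K) a b = b := rfl

@[simp] lemma form_coe (c : K) (a b : R) :
    form (c : OnePoint K) a b = a - algebraMap K R c * b := rfl

lemma form_zero (a b : R) : form ((0 : K) : OnePoint K) a b = a := by simp

end

lemma ratio_eq_iff {a b : K} (hab : a ≠ 0 ∨ b ≠ 0) (t : OnePoint K) :
    ratio a b = t ↔ form t a b = 0 := by
  unfold ratio
  induction t with
  | infty => by_cases hb : b = 0 <;> simp [hb]
  | coe c =>
    by_cases hb : b = 0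
    · simpa [hb] using hab
    · simp only [hb, if_false, OnePoint.coe_eq_coe, form_coe, Algebra.algebraMap_self,
        RingHom.id_apply]
      rw [div_eq_iff hb, sub_eq_zero]

lemma eval_form (t : OnePoint K) (g h : K[X]) (x : K) :
    (form t g h).eval x = form t (g.eval x) (h.eval x) := by
  induction t <;> simp

lemma coeff_form (t : OnePoint K) (g h : K[X]) (n : ℕ) :
    (form t g h).coeff n = form t (g.coeff n) (h.coeff n) := by
  induction t <;> simp

lemma eval_ne_zero_or {g h : K[X]} (hgh : IsCoprime g h) (x : K) :
    g.eval x ≠ 0 ∨ h.eval x ≠ 0 := by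
  obtain ⟨a, b, hab⟩ := hgh
  by_contra! hc
  have := congrArg (eval x) hab
  simp [hc.1, hc.2] at this

lemma coeff_max_ne_zero_or {g h : K[X]} (hd : 1 ≤ max g.natDegree h.natDegree) :
    g.coeff (max g.natDegree h.natDegree) ≠ 0 ∨ h.coeff (max g.natDegree h.natDegree) ≠ 0 := by
  rcases le_total g.natDegree h.natDegree with hle | hle
  · right
    rw [max_eq_right hle] at hd ⊢
    exact leadingCoeff_ne_zero.2 (ne_zero_of_natDegree_gt hd)
  · left
    rw [max_eq_left hle] at hd ⊢
    exact leadingCoeff_ne_zero.2 (ne_zero_of_natDegree_gt hd)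

lemma projMap_coe_eq_iff {g h : K[X]} (hgh : IsCoprime g h) (x : K) (t : OnePoint K) :
    projMap g h x = t ↔ (form t g h).eval x = 0 := by
  rw [eval_form]
  exact ratio_eq_iff (eval_ne_zero_or hgh x) t

lemma projMap_infty_eq_iff {g h : K[X]} (hd : 1 ≤ max g.natDegree h.natDegree) (t : OnePoint K) :
    projMap g h ∞ = t ↔ (form t g h).coeff (max g.natDegree h.natDegree) = 0 := by
  rw [coeff_form]
  exact ratio_eq_iff (coeff_max_ne_zero_or hd) t

lemma natDegree_form_le (t : OnePoint K) (g h : K[X]) :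
    (form t g h).natDegree ≤ max g.natDegree h.natDegree := by
  induction t with
  | infty => simp
  | coe c =>
    simp only [form_coe, algebraMap_eq]
    exact (natDegree_sub_le _ _).trans (max_le_max le_rfl (natDegree_C_mul_le _ _))

lemma form_ne_zero {g h : K[X]} (hgh : IsCoprime g h) (hd : 1 ≤ max g.natDegree h.natDegree)
    (t : OnePoint K) : form t g h ≠ 0 := by
  intro h0
  induction t with
  | infty =>
    simp only [form_infty] at h0
    subst h0
    have := natDegree_eq_zero_of_isUnit (isCoprime_zero_right.1 hgh)
    simp [this] at hd
  | coe c =>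
    rw [form_coe, sub_eq_zero] at h0
    have hu : IsUnit h := hgh.isUnit_of_dvd' (h0 ▸ dvd_mul_left _ _) dvd_rfl
    have hh := natDegree_eq_zero_of_isUnit hu
    have hg : g.natDegree ≤ 0 := by
      rw [h0, algebraMap_eq]
      exact (natDegree_C_mul_le _ _).trans hh.le
    omega

lemma finite_projMap_fiber {g h : K[X]} (hgh : IsCoprime g h)
    (hd : 1 ≤ max g.natDegree h.natDegree) (t : OnePoint K) :
    (projMap g h ⁻¹' {t}).Finite := by
  classical
  refine ((((form t g h).roots.toFinset.finite_toSet).image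
    ((↑) : K → OnePoint K)).insert ∞).subset ?_
  intro s hs
  induction s with
  | infty => simp
  | coe x =>
    right
    refine ⟨x, ?_, rfl⟩
    simpa [form_ne_zero hgh hd] using (projMap_coe_eq_iff hgh x t).1 hs

lemma projMap_surjective [IsAlgClosed K] {g h : K[X]} (hgh : IsCoprime g h)
    (hd : 1 ≤ max g.natDegree h.natDegree) : Function.Surjective (projMap g h) := by
  intro t
  by_cases h0 : (form t g h).natDegree = 0
  · exact ⟨∞, (projMap_infty_eq_iff hd t).2 (coeff_eq_zero_of_natDegree_lt (by omega))⟩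
  · obtain ⟨x, hx⟩ := IsAlgClosed.exists_root (form t g h)
      (fun h' => h0 (natDegree_eq_of_degree_eq_some h'))
    exact ⟨x, (projMap_coe_eq_iff hgh x t).2 hx⟩

/-- A point whose fibre is a single point is totally ramified: the corresponding member of the
pencil spanned by `g` and `h` is the full power of a linear form. -/
lemma form_eq_of_fiber_subsingleton [IsAlgClosed K] {g h : K[X]} (hgh : IsCoprime g h)
    (hd : 1 ≤ max g.natDegree h.natDegree) {s t : OnePoint K}
    (hs : ∀ s', projMap g h s' = t → s' = s) :
    ∃ c : K, c ≠ 0 ∧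
      form t g h = C c * (form s (X : K[X]) 1) ^ max g.natDegree h.natDegree := by
  set P := form t g h with hP
  have hP0 : P ≠ 0 := form_ne_zero hgh hd t
  have hroots : ∀ x ∈ P.roots, (x : OnePoint K) = s := fun x hx =>
    hs x ((projMap_coe_eq_iff hgh x t).2 (isRoot_of_mem_roots hx))
  have hprod := (IsAlgClosed.splits P).eq_prod_roots
  refine ⟨P.leadingCoeff, leadingCoeff_ne_zero.2 hP0, ?_⟩
  induction s with
  | infty =>
    have : P.roots = 0 := Multiset.eq_zero_of_forall_notMem fun x hx => by
      simpa using hroots x hx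
    rw [this] at hprod
    simpa using hprod
  | coe y =>
    have hrep : P.roots = Multiset.replicate P.natDegree y :=
      Multiset.eq_replicate.2 ⟨(IsAlgClosed.splits P).natDegree_eq_card_roots.symm,
        fun x hx => by simpa using hroots x hx⟩
    have hdeg : P.natDegree = max g.natDegree h.natDegree := by
      refine le_antisymm (natDegree_form_le t g h) (not_lt.1 fun hlt => ?_)
      have := hs ∞ ((projMap_infty_eq_iff hd t).2 (coeff_eq_zero_of_natDegree_lt hlt))
      simp at this
    rw [hrep, hdeg] at hprod
    simpa using hprod

end ProjectiveLine

/-! ### Backward orbits covered by finitely many preimages -/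

/-- If the preimage of `S` under the `(n+1)`-st iterate is covered by its preimages under the
earlier iterates, then `S` lies in a finite set on which the surjection `φ` is a bijection and
which is its own full preimage. -/
lemma exists_finite_totally_invariant {α : Type*} {φ : α → α} (hφ : Function.Surjective φ)
    (hfin : ∀ t, (φ ⁻¹' {t}).Finite) {S : Set α} (hS : S.Finite) (n : ℕ)
    (hn : ∀ x, φ^[n + 1] x ∈ S → ∃ j < n, φ^[j + 1] x ∈ S) :
    ∃ T : Set α, T.Finite ∧ S ⊆ T ∧
      ∀ t ∈ T, ∃ s ∈ T, φ s = t ∧ ∀ s', φ s' = t → s' = s := by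
  have hiter : ∀ j, (φ^[j] ⁻¹' S).Finite := by
    intro j
    induction j with
    | zero => simpa using hS
    | succ j ih =>
      rw [Function.iterate_succ, Set.preimage_comp]
      exact ih.preimage' fun b _ => hfin b
  set T : Set α := ⋃ j ∈ Finset.range n, φ^[j + 1] ⁻¹' S with hT
  have hmem : ∀ x, x ∈ T ↔ ∃ j < n, φ^[j + 1] x ∈ S := by simp [hT]
  have hTfin : T.Finite := (Finset.range n).finite_toSet.biUnion fun j _ => hiter _
  have hback : ∀ x, φ x ∈ T → x ∈ T := by
    intro x hx
    obtain ⟨j, hj, hjS⟩ := (hmem _).1 hx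
    rw [← Function.iterate_succ_apply] at hjS
    rcases Nat.lt_or_ge (j + 1) n with hlt | hge
    · exact (hmem _).2 ⟨j + 1, hlt, hjS⟩
    · obtain rfl : j + 1 = n := by omega
      exact (hmem _).2 (hn x hjS)
  set σ := Function.surjInv hφ
  have hσ : ∀ t, φ (σ t) = t := Function.surjInv_eq hφ
  have hσT : Set.MapsTo σ T T := fun t ht => hback _ (by rwa [hσ])
  have hσinj : Function.Injective σ := Function.injective_surjInv hφ
  -- A section of `φ` maps the finite set `T` injectively, hence bijectively, to itself.
  have hσsurj : Set.SurjOn σ T T := by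
    have := hTfin.to_subtype
    intro s hs
    obtain ⟨⟨t, ht⟩, h⟩ := Finite.surjective_of_injective
      (f := hσT.restrict σ T T) (hσT.restrict_inj.2 hσinj.injOn) ⟨s, hs⟩
    exact ⟨t, ht, congrArg Subtype.val h⟩
  have hfwd : ∀ x ∈ T, φ x ∈ T := by
    intro x hx
    obtain ⟨t, ht, rfl⟩ := hσsurj hx
    rwa [hσ]
  refine ⟨T, hTfin, ?_, ?_⟩
  · intro y hy
    obtain ⟨x, rfl⟩ := hφ.iterate (n + 1) y
    have hx : x ∈ T := (hmem x).2 (hn x hy)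
    exact (show Set.MapsTo φ T T from hfwd).iterate (n + 1) hx
  · intro t ht
    refine ⟨σ t, hσT ht, hσ t, fun s' hs' => ?_⟩
    obtain ⟨t', -, rfl⟩ := hσsurj (hback s' (hs' ▸ ht))
    rw [hσ] at hs'
    rw [hs']

/-! ### Linear relations between powers of linear forms -/

section Powers

variable {K : Type*} [Field K]

lemma wronskian_form {x y : OnePoint K} (hxy : x ≠ y) :
    ∃ w : K, w ≠ 0 ∧ wronskian (form x (X : K[X]) 1) (form y (X : K[X]) 1) = C w := by
  induction x with
  | infty =>
    induction y with
    | infty => exact absurd rfl hxy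
    | coe b => exact ⟨1, one_ne_zero, by simp [wronskian]⟩
  | coe a =>
    induction y with
    | infty => exact ⟨-1, by simp, by simp [wronskian]⟩
    | coe b =>
      refine ⟨b - a, sub_ne_zero.2 fun h => hxy (by rw [h]), ?_⟩
      simp [wronskian]

lemma isCoprime_form {x y : OnePoint K} (hxy : x ≠ y) :
    IsCoprime (form x (X : K[X]) 1) (form y (X : K[X]) 1) := by
  obtain ⟨w, hw, h⟩ := wronskian_form hxy
  refine ⟨C w⁻¹ * derivative (form y (X : K[X]) 1), - C w⁻¹ * derivative (form x (X : K[X]) 1), ?_⟩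
  have h1 : C w⁻¹ * C w = (1 : K[X]) := by rw [← C_mul, inv_mul_cancel₀ hw, C_1]
  rw [wronskian] at h
  linear_combination C w⁻¹ * h + h1

lemma eq_infty_of_isUnit_form {x : OnePoint K} (hx : IsUnit (form x (X : K[X]) 1)) : x = ∞ := by
  induction x with
  | infty => rfl
  | coe a => exact absurd (by simpa using hx) (not_isUnit_X_sub_C a)

/-- If `n = k + 1` is invertible in `K`, the `n`-th powers of three pairwise independent linear forms
are linearly related with nonzero coefficients only for `n = 1`. -/
lemma eq_zero_of_pow_succ_relation {x y z : OnePoint K} (hxy : x ≠ y) (hxz : x ≠ z) (hyz : y ≠ z)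
    {a b c : K} (ha : a ≠ 0) (hb : b ≠ 0) {k : ℕ} (hk : ((k + 1 : ℕ) : K) ≠ 0)
    (h : C a * form x (X : K[X]) 1 ^ (k + 1) + C b * form y (X : K[X]) 1 ^ (k + 1) =
      C c * form z (X : K[X]) 1 ^ (k + 1)) : k = 0 := by
  obtain ⟨u, hu, hxz'⟩ := wronskian_form hxz
  obtain ⟨v, hv, hyz'⟩ := wronskian_form hyz
  have hcop := isCoprime_form hxy
  set p := form x (X : K[X]) 1 with hp
  set q := form y (X : K[X]) 1 with hq
  set r := form z (X : K[X]) 1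
  have hder : C a * p ^ k * derivative p + C b * q ^ k * derivative q =
      C c * r ^ k * derivative r := by
    have := congrArg derivative h
    simp only [derivative_add, derivative_C_mul, derivative_pow_succ] at this
    have hk' : C ((k + 1 : ℕ) : K) ≠ 0 := C_ne_zero.2 hk
    apply mul_left_cancel₀ hk'
    push_cast at this ⊢
    linear_combination this
  -- Eliminating `r ^ k` between the relation and its derivative leaves the Wronskians.
  have helim : C (a * u) * p ^ k + C (b * v) * q ^ k = 0 := by
    rw [C_mul, C_mul, ← hxz', ← hyz', wronskian, wronskian]
    linear_combination derivative r * h - r * hder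
  by_contra hk0
  have key : ∀ {s t : K[X]} {α β : K}, β ≠ 0 → IsCoprime s t →
      C α * s ^ k + C β * t ^ k = 0 → IsUnit s := by
    intro s t α β hβ hst hrel
    rw [← isUnit_pow_iff hk0]
    refine (hst.pow (m := k) (n := k)).isUnit_of_dvd ⟨C (-(β⁻¹ * α)), ?_⟩
    have h2 : C β⁻¹ * C β = (1 : K[X]) := by rw [← C_mul, inv_mul_cancel₀ hβ, C_1]
    simp only [C_neg, C_mul]
    linear_combination C β⁻¹ * hrel - t ^ k * h2
  have hx := eq_infty_of_isUnit_form (key (mul_ne_zero hb hv) hcop helim)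
  have hy := eq_infty_of_isUnit_form (key (mul_ne_zero ha hu) hcop.symm (by rwa [add_comm] at helim))
  exact hxy (hx.trans hy.symm)

/-- In characteristic `p`, the `d`-th powers of three pairwise independent linear forms are
linearly related with nonzero coefficients only if `d` is a power of `p`. -/
lemma exists_eq_pow_of_pow_relation [IsAlgClosed K] (p : ℕ) [CharP K p] {x y z : OnePoint K}
    (hxy : x ≠ y) (hxz : x ≠ z) (hyz : y ≠ z) {a b c : K} (ha : a ≠ 0) (hb : b ≠ 0) {d : ℕ}
    (hd : d ≠ 0)
    (h : C a * form x (X : K[X]) 1 ^ d + C b * form y (X : K[X]) 1 ^ d =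
      C c * form z (X : K[X]) 1 ^ d) : ∃ l, d = p ^ l := by
  rcases CharP.char_is_prime_or_zero K p with hp | rfl
  · have := Fact.mk hp
    obtain ⟨l, e, hpe, rfl⟩ := Nat.exists_eq_pow_mul_and_not_dvd hd p hp.ne_one
    refine ⟨l, ?_⟩
    have hq : 0 < p ^ l := pow_pos hp.pos l
    -- Extract `p ^ l`-th roots of the coefficients and of the whole relation.
    obtain ⟨a, rfl⟩ := IsAlgClosed.exists_pow_nat_eq a hq
    obtain ⟨b, rfl⟩ := IsAlgClosed.exists_pow_nat_eq b hq
    obtain ⟨c, rfl⟩ := IsAlgClosed.exists_pow_nat_eq c hq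
    have hroot : C a * form x (X : K[X]) 1 ^ e + C b * form y (X : K[X]) 1 ^ e =
        C c * form z (X : K[X]) 1 ^ e := by
      rw [← sub_eq_zero, ← pow_eq_zero_iff hq.ne', sub_pow_char_pow, add_pow_char_pow, sub_eq_zero]
      simpa only [mul_pow, C_pow, ← pow_mul, mul_comm e] using h
    obtain ⟨k, rfl⟩ : ∃ k, e = k + 1 := Nat.exists_eq_succ_of_ne_zero (by rintro rfl; simp at hpe)
    rw [eq_zero_of_pow_succ_relation hxy hxz hyz (ne_zero_pow hq.ne' ha) (ne_zero_pow hq.ne' hb)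
      (fun h0 => hpe ((CharP.cast_eq_zero_iff K p _).1 h0)) hroot]
    simp
  · obtain ⟨k, rfl⟩ := Nat.exists_eq_succ_of_ne_zero hd
    have := CharP.charP_to_charZero K
    rw [eq_zero_of_pow_succ_relation hxy hxz hyz ha hb (by exact_mod_cast k.succ_ne_zero) h]
    exact ⟨0, by simp⟩

/-- If `g` becomes a multiple of the `q`-th power of a linear form over an extension field, where
`q` is a power of the characteristic, then `g` is a polynomial in `X ^ q` of degree at most one. -/
lemma exists_expand_eq {F : Type*} [Field F] [Algebra F K] (p : ℕ) [Fact p.Prime] [CharP K p]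
    {g : F[X]} {l : ℕ} {a : K} {s : OnePoint K}
    (h : g.map (algebraMap F K) = C a * form s (X : K[X]) 1 ^ p ^ l) :
    ∃ g₁ g₀ : F, g = expand F (p ^ l) (C g₁ * X + C g₀) := by
  have hq : p ^ l ≠ 0 := pow_ne_zero l (Fact.out : p.Prime).ne_zero
  obtain ⟨u, v, huv⟩ : ∃ u v : K, C a * form s (X : K[X]) 1 ^ p ^ l = C u * X ^ p ^ l + C v := by
    induction s with
    | infty => exact ⟨0, a, by simp⟩
    | coe x =>
      refine ⟨a, -(a * x ^ p ^ l), ?_⟩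
      simp only [form_coe, algebraMap_eq, mul_one, sub_pow_char_pow, C_neg, C_mul, C_pow]
      ring
  rw [huv] at h
  have h1 : algebraMap F K (g.coeff (p ^ l)) = u := by
    rw [← coeff_map, h]
    simp [coeff_C, (Fact.out : p.Prime).ne_zero]
  have h0 : algebraMap F K (g.coeff 0) = v := by
    rw [← coeff_map, h]
    simp [coeff_X_pow, hq.symm]
  refine ⟨g.coeff (p ^ l), g.coeff 0, map_injective _ (algebraMap F K).injective ?_⟩
  simp [h, h1, h0]

end Powers

/-! ### Specialization at a point -/

section Specialization

variable {K L Γ₀ : Type*} [Field K] [Field L] [Algebra K L] [LinearOrderedCommGroupWithZero Γ₀]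

/-- The element `u` of a valued extension `L` of `K` has residue `t ∈ ℙ¹(K) = OnePoint K`. -/
def SpecializesTo (v : Valuation L Γ₀) (u : L) (t : OnePoint K) : Prop :=
  t.elim (1 < v u) fun c => v (u - algebraMap K L c) < 1

variable {v : Valuation L Γ₀}

@[simp] lemma specializesTo_infty {u : L} : SpecializesTo v u (∞ : OnePoint K) ↔ 1 < v u := Iff.rfl

@[simp] lemma specializesTo_coe {u : L} {c : K} :
    SpecializesTo v u (c : OnePoint K) ↔ v (u - algebraMap K L c) < 1 := Iff.rfl

variable [v.IsTrivialOn K]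

lemma valuation_eq_one_of_specializesTo {u : L} {c : K} (hc : c ≠ 0)
    (hu : v (u - algebraMap K L c) < 1) : v u = 1 := by
  have h1 := Valuation.IsTrivialOn.eq_one (v := v) c hc
  rw [← h1] at hu ⊢
  rw [← v.map_add_eq_of_lt_right hu, sub_add_cancel]

lemma SpecializesTo.valuation_eq_one_iff {u : L} {t : OnePoint K} (hu : SpecializesTo v u t) :
    v u = 1 ↔ t ∉ ({((0 : K) : OnePoint K), ∞} : Set (OnePoint K)) := by
  induction t with
  | infty => simpa using (specializesTo_infty.1 hu).ne'
  | coe c =>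
    by_cases hc : c = 0
    · subst hc
      simpa using (specializesTo_coe.1 hu).ne
    · simpa [hc] using valuation_eq_one_of_specializesTo hc hu

/-- Residues are compatible with quotients, as long as the quotient of residues makes sense
in `ℙ¹(K)`. -/
lemma specializesTo_div {a b : L} {α β : K} (ha : v (a - algebraMap K L α) < 1)
    (hb : v (b - algebraMap K L β) < 1) (hαβ : α ≠ 0 ∨ β ≠ 0) (hb0 : b ≠ 0) :
    SpecializesTo v (a / b) (ratio α β) := by
  unfold ratio
  by_cases hβ : β = 0
  · subst hβ
    have hα : α ≠ 0 := by simpa using hαβ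
    have hvb : v b < 1 := by simpa using hb
    have hvb0 : 0 < v b := zero_lt_iff.2 (v.ne_zero_iff.2 hb0)
    rw [if_pos rfl, specializesTo_infty, map_div₀, valuation_eq_one_of_specializesTo hα ha]
    exact (one_lt_div₀ hvb0).2 hvb
  · have hβL : algebraMap K L β ≠ 0 := by simpa using hβ
    have hvb : v b = 1 := valuation_eq_one_of_specializesTo hβ hb
    rw [if_neg hβ, specializesTo_coe]
    have : a / b - algebraMap K L (α / β) = ((a - algebraMap K L α) -
        algebraMap K L (α / β) * (b - algebraMap K L β)) / b := by
      rw [map_div₀]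
      field_simp
      ring
    rw [this, map_div₀, hvb, div_one]
    refine v.map_sub_lt ha ?_
    rw [map_mul, mul_comm]
    exact mul_lt_one_of_lt_of_le hb (Valuation.IsTrivialOn.valuation_algebraMap_le_one (v := v) _)

lemma valuation_aeval_le_one {u : L} (hu : v u ≤ 1) (p : K[X]) : v (aeval u p) ≤ 1 := by
  induction p using Polynomial.induction_on' with
  | add p q hp hq => rw [map_add]; exact v.map_add_le hp hq
  | monomial n a =>
    rw [aeval_monomial, map_mul, map_pow]
    exact mul_le_one' (Valuation.IsTrivialOn.valuation_algebraMap_le_one (v := v) _)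
      (pow_le_one' hu n)

lemma valuation_aeval_sub_lt_one {u : L} {c : K} (hu : v (u - algebraMap K L c) < 1) (p : K[X]) :
    v (aeval u p - algebraMap K L (p.eval c)) < 1 := by
  have hu1 : v u ≤ 1 := by
    rw [← sub_add_cancel u (algebraMap K L c)]
    exact v.map_add_le hu.le (Valuation.IsTrivialOn.valuation_algebraMap_le_one (v := v) _)
  obtain ⟨k, hk⟩ : X - C c ∣ p - C (p.eval c) := dvd_iff_isRoot.2 (by simp)
  have := congrArg (aeval u) hk
  simp only [map_sub, map_mul, aeval_X, aeval_C] at this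
  rw [this, map_mul]
  exact mul_lt_one_of_lt_of_le hu (valuation_aeval_le_one hu1 k)

/-- If `u` has residue `t`, then `g(u) / h(u)` has residue `(g / h)(t)`. -/
lemma SpecializesTo.aeval_div {u : L} {t : OnePoint K} (hu : SpecializesTo v u t) {g h : K[X]}
    (hgh : IsCoprime g h) (hd : 1 ≤ max g.natDegree h.natDegree) (hh : aeval u h ≠ 0) :
    SpecializesTo v (aeval u g / aeval u h) (projMap g h t) := by
  induction t with
  | coe c =>
    exact specializesTo_div (valuation_aeval_sub_lt_one hu g) (valuation_aeval_sub_lt_one hu h)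
      (eval_ne_zero_or hgh c) hh
  | infty =>
    -- Pass to `u⁻¹`, which has residue `0`, and to the reflected polynomials.
    have hu1 : 1 < v u := hu
    have hu0 : u ≠ 0 := by rintro rfl; simp at hu1
    set d := max g.natDegree h.natDegree with hd'
    have hw : v (u⁻¹ - algebraMap K L 0) < 1 := by
      simpa using inv_lt_one_of_one_lt₀ hu1
    have hrefl : ∀ p : K[X], p.natDegree ≤ d → aeval u p = aeval u⁻¹ (reflect d p) * u ^ d := by
      intro p hp
      let := invertibleOfNonzero hu0
      have := eval₂_reflect_mul_pow (algebraMap K L) u d p hp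
      rw [invOf_eq_inv] at this
      exact this.symm
    have heval : ∀ p : K[X], (reflect d p).eval 0 = p.coeff d := by
      intro p
      rw [← coeff_zero_eq_eval_zero, coeff_reflect, revAt_le (Nat.zero_le d), Nat.sub_zero]
    have hg := valuation_aeval_sub_lt_one hw (reflect d g)
    have hh' := valuation_aeval_sub_lt_one hw (reflect d h)
    rw [heval] at hg hh'
    rw [hrefl g (le_max_left _ _), hrefl h (le_max_right _ _),
      mul_div_mul_right _ _ (pow_ne_zero d hu0)]
    refine specializesTo_div hg hh' (coeff_max_ne_zero_or hd) fun h0 => hh ?_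
    rw [hrefl h (le_max_right _ _), h0, zero_mul]

end Specialization

/-- Every point `x` of `ℙ¹(K)` is the residue of `X` under a valuation of `K(X)` over `K`. -/
lemma exists_valuation_specializesTo {K : Type*} [Field K] (x : OnePoint K) :
    ∃ v : Valuation (RatFunc K) (WithZero (Multiplicative ℤ)),
      v.IsTrivialOn K ∧ SpecializesTo v RatFunc.X x := by
  classical
  induction x with
  | infty =>
    refine ⟨RatFunc.inftyValuation K, inferInstance, ?_⟩
    rw [specializesTo_infty, RatFunc.inftyValuation.X, ← WithZero.exp_zero,
      WithZero.exp_lt_exp]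
    exact one_pos
  | coe c =>
    let P : IsDedekindDomain.HeightOneSpectrum K[X] :=
      { asIdeal := Ideal.span {X - C c}
        isPrime := (Ideal.span_singleton_prime (X_sub_C_ne_zero c)).2 (prime_X_sub_C c)
        ne_bot := by simpa using X_sub_C_ne_zero c }
    refine ⟨P.valuation (RatFunc K), ⟨fun a ha => ?_⟩, ?_⟩
    · rw [IsScalarTower.algebraMap_apply K K[X] (RatFunc K),
        IsDedekindDomain.HeightOneSpectrum.valuation_eq_one_iff_notMem]
      exact fun hmem => P.isPrime.ne_top (Ideal.eq_top_of_isUnit_mem _ hmem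
        (isUnit_C.2 (isUnit_iff_ne_zero.2 ha)))
    · rw [specializesTo_coe, IsScalarTower.algebraMap_apply K K[X] (RatFunc K), ← RatFunc.algebraMap_X,
        ← map_sub, IsDedekindDomain.HeightOneSpectrum.valuation_lt_one_iff_mem]
      exact Ideal.mem_span_singleton_self _

/-! ### Iterates of a rational function -/

section Iterates

variable {F : Type*} [Field F]

lemma natDegree_num_denom_div {g h : F[X]} (hh : h ≠ 0) (hgh : IsCoprime g h) :
    (algebraMap F[X] (RatFunc F) g / algebraMap F[X] (RatFunc F) h).num.natDegree = g.natDegree ∧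
    (algebraMap F[X] (RatFunc F) g / algebraMap F[X] (RatFunc F) h).denom.natDegree =
      h.natDegree := by
  set f := algebraMap F[X] (RatFunc F) g / algebraMap F[X] (RatFunc F) h with hf
  have hrel : f.num * h = g * f.denom := (RatFunc.num_mul_eq_mul_denom_iff hh).2 hf
  constructor <;> refine natDegree_eq_of_degree_eq (degree_eq_degree_of_associated
    (associated_of_dvd_dvd ?_ ?_))
  · exact RatFunc.num_div_dvd g hh
  · exact hgh.dvd_of_dvd_mul_right (hrel ▸ dvd_mul_right _ _)
  · exact RatFunc.denom_div_dvd g h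
  · exact hgh.symm.dvd_of_dvd_mul_left (hrel ▸ dvd_mul_left _ _)

lemma degree_div {g h : F[X]} (hh : h ≠ 0) (hgh : IsCoprime g h) :
    RatIter.degree (algebraMap F[X] (RatFunc F) g / algebraMap F[X] (RatFunc F) h) =
      max g.natDegree h.natDegree := by
  rw [RatIter.degree, (natDegree_num_denom_div hh hgh).1, (natDegree_num_denom_div hh hgh).2]

lemma comp_eq (f u : RatFunc F) : RatIter.comp f u = aeval u f.num / aeval u f.denom := rfl

lemma comp_div {g h : F[X]} (hh : h ≠ 0) {u : RatFunc F} (hu : aeval u h ≠ 0) :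
    RatIter.comp (algebraMap F[X] (RatFunc F) g / algebraMap F[X] (RatFunc F) h) u =
      aeval u g / aeval u h := by
  set f := algebraMap F[X] (RatFunc F) g / algebraMap F[X] (RatFunc F) h with hf
  have hrel : f.num * h = g * f.denom := (RatFunc.num_mul_eq_mul_denom_iff hh).2 hf
  have hden : aeval u f.denom ≠ 0 := by
    obtain ⟨k, hk⟩ := RatFunc.denom_div_dvd g h
    intro h0
    exact hu (by rw [hk, map_mul, ← hf, h0, zero_mul])
  rw [comp_eq, div_eq_div_iff hden hu, ← map_mul, ← map_mul, hrel]

lemma not_eq_C_of_one_le_degree {f : RatFunc F} (hf : 1 ≤ RatIter.degree f) :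
    ¬ ∃ c, f = RatFunc.C c := by
  rw [RatFunc.eq_C_iff]
  unfold RatIter.degree at hf
  omega

lemma transcendental_iter {f : RatFunc F} (hf : 1 ≤ RatIter.degree f) (k : ℕ) :
    Transcendental F (RatIter.iter f k) := by
  induction k with
  | zero => exact RatFunc.transcendental_X
  | succ k ih =>
    intro halg
    -- `w ↦ w(u)` is a field embedding `F(X) → F(X)` whenever `u` is transcendental.
    let φ : RatFunc F →ₐ[F] RatFunc F := (IntermediateField.val _).comp
      (RatFunc.algEquivOfTranscendental (RatIter.iter f k) ih).toAlgHom
    have hφ : φ f = RatIter.iter f (k + 1) :=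
      RatFunc.algEquivOfTranscendental_apply (RatIter.iter f k) ih f
    rw [← hφ, isAlgebraic_algHom_iff φ φ.toRingHom.injective] at halg
    exact RatFunc.transcendental_of_ne_C f (not_eq_C_of_one_le_degree hf) halg

section BaseChange

variable (K : Type*) [Field K] [Algebra F K]

/-- The embedding `F(X) → K(X)` for a field extension `K / F`. -/
noncomputable def baseChange : RatFunc F →+* RatFunc K :=
  RatFunc.mapRingHom (Polynomial.mapRingHom (algebraMap F K))
    (nonZeroDivisors_le_comap_nonZeroDivisors_of_injective _
      (Polynomial.map_injective _ (algebraMap F K).injective))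

lemma baseChange_algebraMap (g : F[X]) :
    baseChange K (algebraMap F[X] (RatFunc F) g) =
      algebraMap K[X] (RatFunc K) (g.map (algebraMap F K)) := by
  have := RatFunc.map_apply_div (Polynomial.mapRingHom (algebraMap F K))
    (nonZeroDivisors_le_comap_nonZeroDivisors_of_injective _
      (Polynomial.map_injective _ (algebraMap F K).injective)) g 1
  simpa [baseChange, RatFunc.coe_mapRingHom_eq_coe_map] using this

lemma baseChange_X : baseChange K (RatFunc.X : RatFunc F) = RatFunc.X := by
  rw [← RatFunc.algebraMap_X, baseChange_algebraMap, map_X, RatFunc.algebraMap_X]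

lemma baseChange_aeval (u : RatFunc F) (g : F[X]) :
    baseChange K (aeval u g) = aeval (baseChange K u) (g.map (algebraMap F K)) := by
  rw [aeval_def, hom_eval₂, aeval_def, eval₂_map]
  congr 1
  ext c
  have := baseChange_algebraMap K (C c : F[X])
  rw [map_C] at this
  simpa [RatFunc.algebraMap_C, RatFunc.algebraMap_eq_C] using this

end BaseChange

/-- The self-map of `ℙ¹(K)` induced by a rational function over the subfield `F`. -/
noncomputable def pointMap (K : Type*) [Field K] [Algebra F K] (f : RatFunc F) :
    OnePoint K → OnePoint K :=
  projMap (f.num.map (algebraMap F K)) (f.denom.map (algebraMap F K))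

section Points

variable {K : Type*} [Field K] [Algebra F K]

lemma isCoprime_map_num_denom (f : RatFunc F) :
    IsCoprime (f.num.map (algebraMap F K)) (f.denom.map (algebraMap F K)) :=
  f.isCoprime_num_denom.map (Polynomial.mapRingHom (algebraMap F K))

lemma max_natDegree_map_num_denom (f : RatFunc F) :
    max (f.num.map (algebraMap F K)).natDegree (f.denom.map (algebraMap F K)).natDegree =
      RatIter.degree f := by
  rw [natDegree_map, natDegree_map, RatIter.degree]

/-- At the point `x`, the `k`-th iterate of `f` takes the value obtained by iterating the
self-map of `ℙ¹(K)` on `x`. -/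
lemma specializesTo_iter {Γ₀ : Type*} [LinearOrderedCommGroupWithZero Γ₀]
    {v : Valuation (RatFunc K) Γ₀} [v.IsTrivialOn K] {x : OnePoint K}
    (hx : SpecializesTo v RatFunc.X x) {f : RatFunc F} (hf : 1 ≤ RatIter.degree f) (k : ℕ) :
    SpecializesTo v (baseChange K (RatIter.iter f k)) ((pointMap K f)^[k] x) := by
  induction k with
  | zero => simpa [RatIter.iter, baseChange_X] using hx
  | succ k ih =>
    rw [Function.iterate_succ_apply', RatIter.iter, comp_eq, map_div₀, baseChange_aeval,
      baseChange_aeval]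
    refine ih.aeval_div (isCoprime_map_num_denom f) (by rwa [max_natDegree_map_num_denom]) ?_
    rw [← baseChange_aeval]
    refine (_root_.map_ne_zero _).2 fun h0 => f.denom_ne_zero ?_
    exact (transcendental_iff.1 (transcendental_iter hf k)) _ h0

/-- In a multiplicative relation between iterates, every zero or pole of the last one that occurs
is a zero or pole of an earlier one. -/
lemma exists_iterate_mem_of_prod_eq_one {f : RatFunc F} (hf : 1 ≤ RatIter.degree f) {n : ℕ}
    {k : Fin n → ℤ} (hrel : ∏ i : Fin n, RatIter.iter f ((i : ℕ) + 1) ^ k i = 1) {m : Fin n}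
    (hm : k m ≠ 0) (hmax : ∀ i, m < i → k i = 0) (x : OnePoint K)
    (hx : (pointMap K f)^[(m : ℕ) + 1] x ∈ ({((0 : K) : OnePoint K), ∞} : Set (OnePoint K))) :
    ∃ j < (m : ℕ),
      (pointMap K f)^[j + 1] x ∈ ({((0 : K) : OnePoint K), ∞} : Set (OnePoint K)) := by
  by_contra! hno
  obtain ⟨v, hv, hvx⟩ := exists_valuation_specializesTo x
  have hval := congrArg (fun u => v (baseChange K u)) hrel
  simp only [map_prod, map_zpow₀, map_one] at hval
  rw [Finset.prod_eq_single m] at hval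
  · rw [zpow_eq_one_iff_right₀ zero_le] at hval
    · exact hm hval
    · rw [Ne, (specializesTo_iter hvx hf _).valuation_eq_one_iff]
      exact fun h => h hx
  · intro i _ him
    rcases lt_or_gt_of_ne him with hlt | hgt
    · rw [((specializesTo_iter hvx hf _).valuation_eq_one_iff).2 (hno i hlt), one_zpow]
    · rw [hmax i hgt, zpow_zero]
  · simp

end Points

end Iterates

/-! ### Rational functions that are linear in a power of `X` -/

section Expand

variable {F : Type*} [Field F]

lemma exists_comp_of_expand {f : RatFunc F} {g h : F[X]} {q : ℕ} (hq : q ≠ 0)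
    (hnum : f.num = expand F q g) (hden : f.denom = expand F q h)
    (hdeg : RatIter.degree f = q) :
    ∃ L : RatFunc F, RatIter.degree L = 1 ∧ f = RatIter.comp L (RatFunc.X ^ q) := by
  have hh : h ≠ 0 := by
    rintro rfl
    exact f.denom_ne_zero (by simp [hden])
  have hgh : IsCoprime g h := by
    rw [← isCoprime_expand hq, ← hnum, ← hden]
    exact f.isCoprime_num_denom
  have haeval : ∀ p : F[X], aeval (RatFunc.X ^ q : RatFunc F) p =
      algebraMap F[X] (RatFunc F) (expand F q p) := fun p => by
    rw [← expand_aeval, RatFunc.aeval_X_left_eq_algebraMap]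
  refine ⟨algebraMap F[X] (RatFunc F) g / algebraMap F[X] (RatFunc F) h, ?_, ?_⟩
  · rw [RatIter.degree, hnum, hden, natDegree_expand, natDegree_expand,
      ← max_mul_of_nonneg _ _ q.zero_le] at hdeg
    rw [degree_div hh hgh]
    exact Nat.eq_of_mul_eq_mul_right (Nat.pos_of_ne_zero hq) (by rw [hdeg, one_mul])
  · rw [comp_div hh, haeval, haeval, ← hnum, ← hden, RatFunc.num_div_denom]
    rw [haeval, ← hden]
    exact RatFunc.algebraMap_ne_zero f.denom_ne_zero

/-- The polynomial `f.num - f * f.denom` is irreducible over `F(f)` and vanishes at `X`, so if its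
derivative is zero then `F(X) / F(f)` is inseparable. -/
lemma not_separable_of_derivative_eq_zero {f : RatFunc F} (hf : 1 ≤ RatIter.degree f)
    (hnum : derivative f.num = 0) (hden : derivative f.denom = 0) : ¬ RatIter.Separable f := by
  intro hsep
  have hirr := f.irreducible_minpolyX (not_eq_C_of_one_le_degree hf)
  have hdvd := minpoly.dvd _ _ f.minpolyX_aeval_X
  have hsepX : (minpoly (IntermediateField.adjoin F {f}) (RatFunc.X : RatFunc F)).Separable :=
    hsep.isSeparable' _
  have hsepX' := (hsep.isSeparable' (RatFunc.X : RatFunc F)).isIntegral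
  have hass := (minpoly.irreducible hsepX').associated_of_dvd hirr hdvd
  have := hsepX.of_dvd hass.symm.dvd
  rw [separable_iff_derivative_ne_zero hirr] at this
  exact this (by simp [RatFunc.minpolyX, derivative_map, hnum, hden])

end Expand

/-! ### Functions with a finite totally invariant set -/

section Exceptional

variable {F : Type*} [Field F] {K : Type*} [Field K] [Algebra F K]

lemma exists_eq_C_mul_X_pow {g : F[X]} {a : K} {d : ℕ} {s : OnePoint K}
    (hs : s ∈ ({((0 : K) : OnePoint K), ∞} : Set (OnePoint K)))
    (h : g.map (algebraMap F K) = C a * form s (X : K[X]) 1 ^ d) :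
    ∃ (b : F) (e : ℕ), g = C b * X ^ e := by
  obtain ⟨e, he⟩ : ∃ e, g.map (algebraMap F K) = C a * X ^ e := by
    rcases hs with rfl | rfl
    · exact ⟨d, by simpa using h⟩
    · exact ⟨0, by simpa using h⟩
  have ha : algebraMap F K (g.coeff e) = a := by
    rw [← coeff_map, he]
    simp
  exact ⟨g.coeff e, e, map_injective _ (algebraMap F K).injective (by simp [he, ha])⟩

/-- Let `T ⊇ {0, ∞}` be a set over each point of which `f` has a single preimage, lying in `T`.
If `T = {0, ∞}`, then `f` is a monomial. Otherwise `f` is totally ramified over a third point,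
and its numerator and denominator are linear in `X ^ q` for a power `q` of the characteristic. -/
lemma monomial_or_expand [IsAlgClosed K] (p : ℕ) [CharP K p] {f : RatFunc F}
    (hf : 2 ≤ RatIter.degree f) {T : Set (OnePoint K)}
    (hST : {((0 : K) : OnePoint K), ∞} ⊆ T)
    (hT : ∀ t ∈ T, ∃ s ∈ T, pointMap K f s = t ∧ ∀ s', pointMap K f s' = t → s' = s) :
    (∃ (a : F) (m : ℤ), f = RatFunc.C a * RatFunc.X ^ m) ∨
    (p.Prime ∧ ∃ l, RatIter.degree f = p ^ l ∧ ∃ g₁ g₀ h₁ h₀ : F,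
      f.num = expand F (p ^ l) (C g₁ * X + C g₀) ∧
      f.denom = expand F (p ^ l) (C h₁ * X + C h₀)) := by
  have hdeg : 1 ≤ max (f.num.map (algebraMap F K)).natDegree
      (f.denom.map (algebraMap F K)).natDegree := by
    rw [max_natDegree_map_num_denom]
    omega
  have hpow : ∀ {s t : OnePoint K}, (∀ s', pointMap K f s' = t → s' = s) → ∃ c : K, c ≠ 0 ∧
      form t (f.num.map (algebraMap F K)) (f.denom.map (algebraMap F K)) =
        C c * form s (X : K[X]) 1 ^ RatIter.degree f := by
    intro s t hs
    have := form_eq_of_fiber_subsingleton (isCoprime_map_num_denom f) hdeg hs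
    rwa [max_natDegree_map_num_denom] at this
  obtain ⟨x, hxT, hx, hx'⟩ := hT _ (hST (Set.mem_insert _ _))
  obtain ⟨y, hyT, hy, hy'⟩ := hT _ (hST (Set.mem_insert_of_mem _ rfl))
  obtain ⟨a, ha, hnum⟩ := hpow hx'
  obtain ⟨b, hb, hden⟩ := hpow hy'
  rw [form_zero] at hnum
  rw [form_infty] at hden
  by_cases hTS : T ⊆ {((0 : K) : OnePoint K), ∞}
  · left
    obtain ⟨α, i, hα⟩ := exists_eq_C_mul_X_pow (hTS hxT) hnum
    obtain ⟨β, j, hβ⟩ := exists_eq_C_mul_X_pow (hTS hyT) hden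
    refine ⟨α / β, i - j, ?_⟩
    rw [← RatFunc.num_div_denom f, hα, hβ, zpow_sub₀ RatFunc.X_ne_zero]
    simp only [map_mul, map_pow, RatFunc.algebraMap_C, RatFunc.algebraMap_X, map_div₀, zpow_natCast]
    rw [mul_div_mul_comm]
  · right
    obtain ⟨t, htT, htS⟩ := Set.not_subset.1 hTS
    obtain ⟨z, -, hz, hz'⟩ := hT t htT
    obtain ⟨c, hc, hthird⟩ := hpow hz'
    have hxy : x ≠ y := by
      rintro rfl
      exact OnePoint.coe_ne_infty (0 : K) (hx.symm.trans hy)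
    have hxz : x ≠ z := by
      rintro rfl
      exact htS (Or.inl (hz.symm.trans hx))
    have hyz : y ≠ z := by
      rintro rfl
      exact htS (Or.inr (hz.symm.trans hy))
    induction t with
    | infty => simp at htS
    | coe τ =>
      have hτ : τ ≠ 0 := by
        rintro rfl
        simp at htS
      rw [form_coe, hnum, hden, algebraMap_eq] at hthird
      obtain ⟨l, hl⟩ := exists_eq_pow_of_pow_relation p hxy hxz hyz ha
        (neg_ne_zero.2 (mul_ne_zero hτ hb)) (by omega) (c := c) (d := RatIter.degree f) (by
          rw [C_neg, C_mul]
          linear_combination hthird)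
      have hp : p.Prime := by
        rcases CharP.char_is_prime_or_zero K p with hp | rfl
        · exact hp
        · have : (0 : ℕ) ^ l ≤ 1 := pow_le_one₀ le_rfl zero_le_one
          omega
      have := Fact.mk hp
      rw [hl] at hnum hden
      obtain ⟨g₁, g₀, hg⟩ := exists_expand_eq p hnum
      obtain ⟨h₁, h₀, hh⟩ := exists_expand_eq p hden
      exact ⟨hp, l, hl, g₁, g₀, h₁, h₀, hg, hh⟩

end Exceptional

end IterateIndependence

theorem corollary2 {F : Type*} [Field F] (p : ℕ) [CharP F p]
    (g h : F[X]) (hh : h ≠ 0) (hgh : IsCoprime g h)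
    (f : RatFunc F) (hf : f = algebraMap F[X] (RatFunc F) g / algebraMap F[X] (RatFunc F) h)
    (hdeg : 2 ≤ RatIter.degree f)
    (hmon : ¬ ∃ (a : F) (m : ℤ), f = RatFunc.C a * RatFunc.X ^ m)
    (hbin : ¬ ∃ (a b : F) (l : ℕ), f = RatFunc.C a * RatFunc.X ^ (p ^ l) + RatFunc.C b)
    (hconj : ¬ RatIter.LinearlyConjugate f (1 / RatFunc.X ^ RatIter.degree f))
    (hcase : (1 ≤ g.natDegree ∧ g.natDegree ≠ h.natDegree) ∨ RatIter.Separable f ∨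
      ¬ ∃ (L : RatFunc F) (l : ℕ), RatIter.degree L = 1 ∧
        f = RatIter.comp L (RatFunc.X ^ (p ^ l)))
    (n : ℕ) :
    RatIter.MultiplicativelyIndependent (fun i : Fin n => RatIter.iter f ((i : ℕ) + 1)) := by
  open IterateIndependence in
  intro k
  refine ⟨fun hrel => ?_, fun hk => by simp [hk]⟩
  by_contra! hne
  let K := AlgebraicClosure F
  have : CharP K p := charP_of_injective_algebraMap (algebraMap F K).injective p
  obtain ⟨m, hm, hmax⟩ := Finset.exists_max_image (Finset.univ.filter fun i => k i ≠ 0) id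
    (by simpa [Finset.Nonempty] using hne)
  have hm0 : k m ≠ 0 := by simpa using hm
  have hmax' : ∀ i, m < i → k i = 0 := fun i hi => by
    by_contra hi0
    exact absurd hi (not_lt.2 (hmax i (by simpa using hi0)))
  have hdeg1 : 1 ≤ RatIter.degree f := by omega
  have hdegK : 1 ≤ max (f.num.map (algebraMap F K)).natDegree
      (f.denom.map (algebraMap F K)).natDegree := by rwa [max_natDegree_map_num_denom]
  have hcop := isCoprime_map_num_denom (K := K) f
  obtain ⟨T, -, hST, hT⟩ := exists_finite_totally_invariant (φ := pointMap K f)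
    (projMap_surjective hcop hdegK) (finite_projMap_fiber hcop hdegK) (Set.toFinite _) (m : ℕ)
    (exists_iterate_mem_of_prod_eq_one hdeg1 hrel hm0 hmax')
  rcases monomial_or_expand p hdeg hST hT with hmono | ⟨hp, l, hl, g₁, g₀, h₁, h₀, hnum, hden⟩
  · exact hmon hmono
  have hq : p ^ l ≠ 0 := pow_ne_zero l hp.ne_zero
  have hl0 : l ≠ 0 := by
    rintro rfl
    simp at hl
    omega
  rcases hcase with ⟨hg1, hgne⟩ | hsep | hlin
  · -- The denominator has to be constant, so that `f` is a binomial.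
    have hdegs := natDegree_num_denom_div hh hgh
    rw [← hf] at hdegs
    rw [← hdegs.1, ← hdegs.2, hnum, hden, natDegree_expand, natDegree_expand] at hgne
    rw [← hdegs.1, hnum, natDegree_expand] at hg1
    have hh1 : h₁ = 0 := by
      by_contra h10
      rw [natDegree_linear h10] at hgne
      have h2 : (C g₁ * X + C g₀).natDegree ≤ 1 := natDegree_linear_le
      have h3 : (C g₁ * X + C g₀).natDegree ≠ 0 := by
        intro h0
        simp [h0] at hg1
      have h4 : (C g₁ * X + C g₀).natDegree = 1 := by omega
      exact hgne (by rw [h4])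
    refine hbin ⟨g₁ / h₀, g₀ / h₀, l, ?_⟩
    rw [← RatFunc.num_div_denom f, hnum, hden, hh1]
    simp only [map_add, map_mul, expand_C, expand_X, map_pow, RatFunc.algebraMap_C,
      RatFunc.algebraMap_X, map_div₀, map_zero, zero_mul, zero_add]
    ring
  · have hder : ∀ a b : F, derivative (expand F (p ^ l) (C a * X + C b)) = 0 := fun a b => by
      rw [derivative_expand, Nat.cast_pow, CharP.cast_eq_zero, zero_pow hl0]
      simp
    exact not_separable_of_derivative_eq_zero hdeg1 (hnum ▸ hder _ _) (hden ▸ hder _ _) hsep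
  · obtain ⟨L, hL, hfL⟩ := exists_comp_of_expand hq hnum hden hl
    exact hlin ⟨L, l, hL, hfL⟩
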